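/- A \emph{chain} with $n$ chain edges is a sequence of points $p_0,\dots,p_n$ in the plane in general position (no two with the same $x$-coordinate, no three on a line), sorted by increasing $x$-coordinate, such that each edge $p_{i-1}p_i$ ($1\le i\le n$) is contained in every triangulation (edge-maximal crossing-free geometric graph) of $\{p_0,\dots,p_n\}$. These edges are the chain edges and form the chain curve. The \emph{visibility triangle} $V(C)$ of a chain $C$ has, for $0\le i<j\le n$, the entry $V(C)_{i,j}=0$ if $j=i+1$, and otherwise $+1$ or $-1$ according to whether $p_ip_j$ lies above or below the chain curve; chains with the same visibility triangle are considered equal. The \emph{flipped} chain $\overline{C}$ is the reflection of $C$ at the $x$-axis. For chains $C_1,C_2$ with $n_1,n_2$ chain edges, the \emph{convex sum} $C_1\vee C_2$ and the \emph{concave sum} $C_1\wedge C_2$ are the chains with $n_1+n_2$ chain edges whose visibility triangle agrees with that of $C_1$ on the indices $0,\dots,n_1$, agrees with that of $C_2$ (with indices shifted by $n_1$) on the indices $n_1,\dots,n_1+n_2$, and has all entries with $i<n_1<j$ equal to $+1$ for $C_1\vee C_2$ and to $-1$ for $C_1\wedge C_2$. Let $\mathrm{tr}(C)$ be the number of triangulations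 of the points of $C$, and let $U(C)$ be the number of upper triangulations of $C$, i.e. of crossing-free geometric graphs on $C$ that are edge-maximal subject to containing only chain edges and edges $p_ip_j$ with $V(C)_{i,j}=+1$. For a chain $C_0$ and $N\ge 1$ let $$C_{\mathsf{poly}}(C_0,N)=\underbrace{\overline{C_0}\vee\dots\vee\overline{C_0}}_{N\text{ copies}}.$$ \textbf{Lemma.} Let $C_0$ be a chain, and let $C$ be any chain that can be written as a formula involving convex sums, concave sums and exactly $N$ copies of $C_0$. Then $$\mathrm{tr}(C_0)^N\;\le\;\mathrm{tr}(C)\;\le\;U\bigl(C_{\mathsf{poly}}(C_0,N)\bigr)\cdot U\bigl(C_{\mathsf{poly}}(\overline{C_0},N)\bigr).$$ -/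

import Mathlib

/-! ### Straight-line graphs on a finite sequence of points in the plane

A sequence of points `p 0, …, p n` is given by `n : ℕ` and a function `p : ℕ → ℝ × ℝ`; the values
`p i` with `i > n` are never used.  The segment joining `p i` and `p j` is encoded by the index
pair `(i, j)` with `i < j ≤ n`, and a geometric graph by its finite set of edges. -/

namespace PlanarChain

/-- All edges on the points `p 0, …, p n`: the pairs `(i, j)` with `i < j ≤ n`. -/
def edges (n : ℕ) : Finset (ℕ × ℕ) :=
  (Finset.range (n + 1) ×ˢ Finset.range (n + 1)).filter fun e => e.1 < e.2

/-- Two different edges cross if they have a common point in their relative interiors. -/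
def Cross (p : ℕ → ℝ × ℝ) (e f : ℕ × ℕ) : Prop :=
  e ≠ f ∧ (openSegment ℝ (p e.1) (p e.2) ∩ openSegment ℝ (p f.1) (p f.2)).Nonempty

/-- `G` is a crossing-free geometric graph on the points `p 0, …, p n`. -/
def CrossingFree (n : ℕ) (p : ℕ → ℝ × ℝ) (G : Finset (ℕ × ℕ)) : Prop :=
  G ⊆ edges n ∧ ∀ e ∈ G, ∀ f ∈ G, ¬ Cross p e f

/-- A triangulation of a point set is an edge-maximal crossing-free geometric graph on it. -/
def IsTriangulation (n : ℕ) (p : ℕ → ℝ × ℝ) (G : Finset (ℕ × ℕ)) : Prop :=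
  Maximal (CrossingFree n p) G

/-- An edge is unavoidable if it is contained in every triangulation. -/
def Unavoidable (n : ℕ) (p : ℕ → ℝ × ℝ) (e : ℕ × ℕ) : Prop :=
  ∀ G, IsTriangulation n p G → e ∈ G

/-- The polygonal curve `p 0 p 1 … p n`. -/
def curve (n : ℕ) (p : ℕ → ℝ × ℝ) : Set (ℝ × ℝ) :=
  ⋃ i ∈ Finset.range n, segment ℝ (p i) (p (i + 1))

/-- The edge joining `p i` and `p j` lies above the curve `p 0 p 1 … p n`. -/
def LiesAbove (n : ℕ) (p : ℕ → ℝ × ℝ) (i j : ℕ) : Prop :=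
  ∀ q ∈ segment ℝ (p i) (p j), ∀ r ∈ curve n p, r.1 = q.1 → r.2 ≤ q.2

/-- The edge joining `p i` and `p j` lies below the curve `p 0 p 1 … p n`. -/
def LiesBelow (n : ℕ) (p : ℕ → ℝ × ℝ) (i j : ℕ) : Prop :=
  ∀ q ∈ segment ℝ (p i) (p j), ∀ r ∈ curve n p, r.1 = q.1 → q.2 ≤ r.2

open Classical in
/-- The entries (for `i < j ≤ n`) of the visibility triangle: `0` for a chain edge, `+1` for an
edge above the chain curve and `-1` for an edge below it.  (For a chain these are the only cases;
the last default value is not attained.) -/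
noncomputable def visibility (n : ℕ) (p : ℕ → ℝ × ℝ) (i j : ℕ) : ℤ :=
  if i + 1 = j then 0
  else if LiesAbove n p i j then 1
  else if LiesBelow n p i j then -1
  else 0

end PlanarChain

open PlanarChain in
/-- A chain with `n` chain edges: points `p 0, …, p n` in general position, sorted by increasing
`x`-coordinate, such that all the edges joining `p i` and `p (i + 1)` are unavoidable. -/
structure Chain where
  n : ℕ
  p : ℕ → ℝ × ℝ
  x_lt : ∀ i j, i < j → j ≤ n → (p i).1 < (p j).1
  not_collinear : ∀ i j k, i < j → j < k → k ≤ n → ¬ Collinear ℝ {p i, p j, p k}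
  unavoidable : ∀ i, i < n → Unavoidable n p (i, i + 1)

/-! ### Realizability

Facts needed to see that flips and sums of chains are chains again. -/

namespace PlanarChain

/-- Twice the signed area of the triangle `a b c`. -/
def orient (a b c : ℝ × ℝ) : ℝ :=
  (b.1 - a.1) * (c.2 - a.2) - (b.2 - a.2) * (c.1 - a.1)

/-- For all `i < j ≤ n`, the points strictly between `p i` and `p j` are all strictly below, or
all strictly above, the edge joining `p i` and `p j`. -/
def OneSided (n : ℕ) (p : ℕ → ℝ × ℝ) : Prop :=
  ∀ i j, i < j → j ≤ n →
    (∀ k, i < k → k < j → 0 < orient (p i) (p k) (p j)) ∨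
    (∀ k, i < k → k < j → orient (p i) (p k) (p j) < 0)

theorem mem_edges {n : ℕ} {e : ℕ × ℕ} : e ∈ edges n ↔ e.1 < e.2 ∧ e.2 ≤ n := by
  simp only [edges, Finset.mem_filter, Finset.mem_product, Finset.mem_range]
  omega

theorem collinear_iff_orient {a b c : ℝ × ℝ} (h : a.1 < c.1) :
    Collinear ℝ {a, b, c} ↔ orient a b c = 0 := by
  rw [collinear_iff_of_mem (p₀ := a) (by simp)]
  constructor
  · rintro ⟨v, hv⟩
    obtain ⟨s, hs⟩ := hv b (by simp)
    obtain ⟨t, ht⟩ := hv c (by simp)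
    simp [hs, ht, orient]
    ring
  · intro h0
    have hd : c.1 - a.1 ≠ 0 := by linarith
    refine ⟨c - a, ?_⟩
    rintro q (rfl | rfl | rfl)
    · exact ⟨0, by simp⟩
    · refine ⟨(q.1 - a.1) / (c.1 - a.1), ?_⟩
      ext
      · simp; field_simp; ring
      · simp only [orient] at h0
        simp; field_simp; linarith
    · exact ⟨1, by simp⟩

theorem orient_combo (a c q r : ℝ × ℝ) (s t : ℝ) (h : s + t = 1) :
    orient a (s • q + t • r) c = s * orient a q c + t * orient a r c := by
  have : s = 1 - t := by linarith
  subst this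
  simp [orient]
  ring

theorem orient_of_mem_segment {a c q : ℝ × ℝ} (hq : q ∈ segment ℝ a c) : orient a q c = 0 := by
  obtain ⟨s, t, -, -, hst, rfl⟩ := hq
  rw [orient_combo _ _ _ _ _ _ hst]
  simp [orient]
  right; ring

theorem orient_same_x {a c q r : ℝ × ℝ} (hq : q ∈ segment ℝ a c) (hx : r.1 = q.1) :
    orient a r c = (q.2 - r.2) * (c.1 - a.1) := by
  have := orient_of_mem_segment hq
  simp only [orient] at *
  rw [hx]
  linarith

theorem exists_mem_segment {a c : ℝ × ℝ} {x : ℝ} (h1 : a.1 < x) (h2 : x < c.1) :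
    ∃ q ∈ openSegment ℝ a c, q.1 = x := by
  have hd : 0 < c.1 - a.1 := by linarith
  refine ⟨((c.1 - x) / (c.1 - a.1)) • a + ((x - a.1) / (c.1 - a.1)) • c,
    ⟨_, _, div_pos (by linarith) hd, div_pos (by linarith) hd, ?_, rfl⟩, ?_⟩
  · field_simp; ring
  · simp; field_simp; ring

theorem fst_mem_Icc {a c q : ℝ × ℝ} (h : a.1 ≤ c.1) (hq : q ∈ segment ℝ a c) :
    a.1 ≤ q.1 ∧ q.1 ≤ c.1 := by
  obtain ⟨s, t, hs, ht, hst, rfl⟩ := hq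
  have : s = 1 - t := by linarith
  subst this
  simp
  constructor <;> nlinarith

theorem fst_mem_Ioo {a c q : ℝ × ℝ} (h : a.1 < c.1) (hq : q ∈ openSegment ℝ a c) :
    a.1 < q.1 ∧ q.1 < c.1 := by
  obtain ⟨s, t, hs, ht, hst, rfl⟩ := hq
  have : s = 1 - t := by linarith
  subst this
  simp
  constructor <;> nlinarith

section
variable {n : ℕ} {p : ℕ → ℝ × ℝ}

theorem curve_mem {k : ℕ} (hk : k ≤ n)
    (hn : 0 < n) : p k ∈ curve n p := by
  simp only [curve, Set.mem_iUnion, Finset.mem_range]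
  rcases Nat.lt_or_ge k n with h | h
  · exact ⟨k, h, left_mem_segment _ _ _⟩
  · refine ⟨n - 1, by omega, ?_⟩
    have : k = n - 1 + 1 := by omega
    rw [← this]
    exact right_mem_segment _ _ _

/-- Points of the curve on a vertical line that meets the edge from `p i` to `p j` are points of
the part of the curve between `p i` and `p j`. -/
theorem curve_between (hx : ∀ i j, i < j → j ≤ n → (p i).1 < (p j).1) {i j : ℕ} (hij : i < j)
    (hj : j ≤ n) {r : ℝ × ℝ} (hr : r ∈ curve n p) (h1 : (p i).1 ≤ r.1) (h2 : r.1 ≤ (p j).1) :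
    ∃ k, i ≤ k ∧ k < j ∧ r ∈ segment ℝ (p k) (p (k + 1)) := by
  simp only [curve, Set.mem_iUnion, Finset.mem_range] at hr
  obtain ⟨k, hk, hr⟩ := hr
  have hkk := hx k (k + 1) (by omega) (by omega)
  have hle : ∀ a b, a ≤ b → b ≤ n → (p a).1 ≤ (p b).1 := by
    intro a b hab hb
    rcases hab.eq_or_lt with h | h
    · rw [h]
    · exact (hx a b h hb).le
  obtain ⟨s, t, hs, ht, hst, rfl⟩ := hr
  have hs' : s = 1 - t := by linarith
  subst hs'
  simp at h1 h2
  rcases Nat.lt_or_ge k i with hki | hki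
  · have := hle (k + 1) i (by omega) (by omega)
    have ht1 : t = 1 := by nlinarith
    subst ht1
    have : k + 1 = i := by
      by_contra hne
      have := hx (k + 1) i (by omega) (by omega)
      linarith
    subst this
    refine ⟨k + 1, le_rfl, hij, ?_⟩
    simpa using left_mem_segment ℝ (p (k + 1)) (p (k + 1 + 1))
  · rcases Nat.lt_or_ge k j with hkj | hkj
    · exact ⟨k, hki, hkj, 1 - t, t, hs, ht, hst, rfl⟩
    · have := hle j k hkj (by omega)
      have ht0 : t = 0 := by nlinarith
      subst ht0
      have : k = j := by
        by_contra hne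
        have := hx j k (by omega) (by omega)
        linarith
      subst this
      refine ⟨k - 1, by omega, by omega, ?_⟩
      have h : k - 1 + 1 = k := by omega
      rw [h]
      simpa using right_mem_segment ℝ (p (k - 1)) (p k)

/-- The edge lies on the side `s = ±1` of the curve iff the intermediate points are on the other
side. -/
theorem side_iff (hx : ∀ i j, i < j → j ≤ n → (p i).1 < (p j).1) (s : ℝ) {i j : ℕ} (hij : i < j)
    (hj : j ≤ n) :
    (∀ q ∈ segment ℝ (p i) (p j), ∀ r ∈ curve n p, r.1 = q.1 → s * r.2 ≤ s * q.2) ↔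
      ∀ k, i < k → k < j → 0 ≤ s * orient (p i) (p k) (p j) := by
  have hd := hx i j hij hj
  constructor
  · intro h k hik hkj
    obtain ⟨q, hq, hqx⟩ := exists_mem_segment (hx i k hik (by omega)) (hx k j hkj hj)
    have hq' := openSegment_subset_segment ℝ _ _ hq
    have := h q hq' (p k) (curve_mem (by omega) (by omega)) hqx.symm
    rw [orient_same_x hq' hqx.symm]
    nlinarith
  · intro h q hq r hr hrq
    have hqx := fst_mem_Icc hd.le hq
    obtain ⟨k, hik, hkj, hr'⟩ := curve_between hx hij hj hr (by linarith) (by linarith)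
    have key : ∀ k, i ≤ k → k ≤ j → 0 ≤ s * orient (p i) (p k) (p j) := by
      intro k h1 h2
      rcases h1.eq_or_lt with rfl | h1
      · simp [orient]
      rcases h2.eq_or_lt with rfl | h2
      · have : orient (p i) (p k) (p k) = 0 := by simp only [orient]; ring
        rw [this]; simp
      exact h k h1 h2
    have h0 : 0 ≤ s * orient (p i) r (p j) := by
      obtain ⟨a, b, ha, hb, hab, rfl⟩ := hr'
      rw [orient_combo _ _ _ _ _ _ hab]
      have h1 := mul_nonneg ha (key k hik hkj.le)
      have h2 := mul_nonneg hb (key (k + 1) (by omega) hkj)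
      nlinarith
    rw [orient_same_x hq hrq] at h0
    by_contra hc
    push Not at hc
    nlinarith

theorem liesAbove_iff (hx : ∀ i j, i < j → j ≤ n → (p i).1 < (p j).1) {i j : ℕ} (hij : i < j)
    (hj : j ≤ n) :
    LiesAbove n p i j ↔ ∀ k, i < k → k < j → 0 ≤ orient (p i) (p k) (p j) := by
  simpa [LiesAbove] using side_iff hx 1 hij hj

theorem liesBelow_iff (hx : ∀ i j, i < j → j ≤ n → (p i).1 < (p j).1) {i j : ℕ} (hij : i < j)
    (hj : j ≤ n) :
    LiesBelow n p i j ↔ ∀ k, i < k → k < j → orient (p i) (p k) (p j) ≤ 0 := by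
  simpa [LiesBelow] using side_iff hx (-1) hij hj

/-- Every crossing-free graph is contained in a triangulation. -/
theorem exists_triangulation {G : Finset (ℕ × ℕ)} (hG : CrossingFree n p G) :
    ∃ T, G ⊆ T ∧ IsTriangulation n p T := by
  have hfin : {H | CrossingFree n p H}.Finite :=
    (edges n).powerset.finite_toSet.subset fun H hH => by simpa using hH.1
  obtain ⟨T, hT, hm⟩ := hfin.exists_le_maximal hG
  exact ⟨T, hT, hm⟩

/-- If consecutive points are joined by unavoidable edges, all sides are well-defined. -/
theorem oneSided_of_unavoidable (hx : ∀ i j, i < j → j ≤ n → (p i).1 < (p j).1)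
    (hc : ∀ i j k, i < j → j < k → k ≤ n → ¬ Collinear ℝ {p i, p j, p k})
    (hu : ∀ i, i < n → Unavoidable n p (i, i + 1)) : OneSided n p := by
  intro i j hij hj
  have hne : ∀ k, i < k → k < j → orient (p i) (p k) (p j) ≠ 0 := fun k h1 h2 h0 =>
    hc i k j h1 h2 hj ((collinear_iff_orient (hx i j hij hj)).2 h0)
  have step : ∀ k, i < k → k + 1 < j →
      ¬ orient (p i) (p k) (p j) * orient (p i) (p (k + 1)) (p j) < 0 := by
    intro k h1 h2 hneg
    have hcf : CrossingFree n p {(i, j)} := by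
      constructor
      · intro e he
        rw [Finset.mem_singleton] at he
        subst he
        exact mem_edges.2 ⟨hij, hj⟩
      · intro e he f hf hef
        rw [Finset.mem_singleton] at he hf
        exact hef.1 (he.trans hf.symm)
    obtain ⟨T, hT, hTr⟩ := exists_triangulation hcf
    have hm := hu k (by omega) T hTr
    have hm' : (i, j) ∈ T := hT (by simp)
    refine hTr.prop.2 _ hm' _ hm ⟨?_, ?_⟩
    · intro h
      have := congrArg Prod.fst h
      simp at this
      omega
    · set u := orient (p i) (p k) (p j) with hu'
      set v := orient (p i) (p (k + 1)) (p j) with hv'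
      have huv : ∃ t : ℝ, 0 < t ∧ t < 1 ∧ (1 - t) * u + t * v = 0 := by
        have hne : u - v ≠ 0 := by
          intro h
          have : u = v := by linarith
          rw [this] at hneg
          nlinarith [mul_self_nonneg v]
        refine ⟨u / (u - v), ?_, ?_, ?_⟩
        · rcases lt_or_ge 0 u with h | h
          · have : v < 0 := by by_contra hc; push Not at hc; nlinarith
            exact div_pos h (by linarith)
          · have h' : u < 0 := lt_of_le_of_ne h (by rintro h; rw [h] at hneg; simp at hneg)
            have : 0 < v := by by_contra hc; push Not at hc; nlinarith
            exact div_pos_of_neg_of_neg h' (by linarith)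
        · rcases lt_or_ge 0 u with h | h
          · have : v < 0 := by by_contra hc; push Not at hc; nlinarith
            rw [div_lt_one (by linarith)]; linarith
          · have h' : u < 0 := lt_of_le_of_ne h (by rintro h; rw [h] at hneg; simp at hneg)
            have : 0 < v := by by_contra hc; push Not at hc; nlinarith
            rw [div_lt_one_of_neg (by linarith)]; linarith
        · field_simp; ring
      obtain ⟨t, ht0, ht1, htz⟩ := huv
      set r := (1 - t) • p k + t • p (k + 1) with hr
      have hrs : r ∈ openSegment ℝ (p k) (p (k + 1)) :=
        ⟨1 - t, t, by linarith, ht0, by ring, rfl⟩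
      have hrx := fst_mem_Ioo (hx k (k + 1) (by omega) (by omega)) hrs
      have hro : orient (p i) r (p j) = 0 := by
        rw [hr, orient_combo _ _ _ _ _ _ (by ring)]
        exact htz
      have a1 := hx i k h1 (by omega)
      have a2 := hx (k + 1) j h2 hj
      obtain ⟨q, hq, hqx⟩ := exists_mem_segment (a := p i) (c := p j) (x := r.1)
        (by linarith) (by linarith)
      have := orient_same_x (openSegment_subset_segment ℝ _ _ hq) hqx.symm
      rw [hro] at this
      have hd := hx i j hij hj
      have hy : q.2 - r.2 = 0 := by
        rcases mul_eq_zero.1 this.symm with h | h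
        · exact h
        · linarith
      have hqr : q = r := Prod.ext hqx (by linarith)
      exact ⟨r, hqr ▸ hq, hrs⟩
  rcases Nat.lt_or_ge (i + 1) j with hlt | hge
  · have all : ∀ m, i + 1 + m < j →
        0 < orient (p i) (p (i + 1)) (p j) * orient (p i) (p (i + 1 + m)) (p j) := by
      intro m
      induction m with
      | zero =>
        intro h
        exact mul_self_pos.2 (hne _ (by omega) h)
      | succ m ih =>
        intro h
        have h1 := ih (by omega)
        have h2 := step (i + 1 + m) (by omega) (by omega)
        have h3 := hne (i + 1 + m + 1) (by omega) (by omega)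
        have h4 := hne (i + 1 + m) (by omega) (by omega)
        have h5 : 0 < orient (p i) (p (i + 1 + m)) (p j) * orient (p i) (p (i + 1 + m + 1)) (p j) :=
          lt_of_le_of_ne (not_lt.1 h2) (mul_ne_zero h4 h3).symm
        have h6 := mul_pos h1 h5
        have h7 := mul_self_pos.2 h4
        rw [← add_assoc]
        by_contra hcon
        push Not at hcon
        nlinarith [mul_nonneg_of_nonpos_of_nonpos hcon (neg_nonpos.2 h7.le)]
    rcases lt_or_gt_of_ne (hne (i + 1) (by omega) hlt) with h | h
    · right
      intro k h1 h2
      have := all (k - (i + 1)) (by omega)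
      rw [Nat.add_sub_cancel' h1] at this
      by_contra hcon
      push Not at hcon
      nlinarith
    · left
      intro k h1 h2
      have := all (k - (i + 1)) (by omega)
      rw [Nat.add_sub_cancel' h1] at this
      by_contra hcon
      push Not at hcon
      nlinarith
  · left
    intro k h1 h2
    omega

theorem not_collinear_of_oneSided (hx : ∀ i j, i < j → j ≤ n → (p i).1 < (p j).1)
    (hs : OneSided n p) :
    ∀ i j k, i < j → j < k → k ≤ n → ¬ Collinear ℝ {p i, p j, p k} := by
  intro i j k hij hjk hk hcol
  have h0 := (collinear_iff_orient (hx i k (by omega) hk)).1 hcol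
  rcases hs i k (by omega) hk with h | h
  · exact (h j hij hjk).ne' h0
  · exact (h j hij hjk).ne h0

theorem not_cross_of_oneSided (hx : ∀ i j, i < j → j ≤ n → (p i).1 < (p j).1)
    (hs : OneSided n p) {k : ℕ} (hk : k < n) {e : ℕ × ℕ} (he : e ∈ edges n) :
    ¬ Cross p e (k, k + 1) := by
  rintro ⟨hne, q, hq1, hq2⟩
  obtain ⟨a, b⟩ := e
  obtain ⟨hab, hb⟩ := mem_edges.1 he
  simp only at hab hb hq1 hq2
  have h1 := fst_mem_Ioo (hx a b hab hb) hq1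
  have h2 := fst_mem_Ioo (hx k (k + 1) (by omega) (by omega)) hq2
  have hak : a ≤ k := by
    by_contra hc
    rcases (show k + 1 ≤ a by omega).eq_or_lt with h | h
    · rw [h] at h2; linarith
    · have := hx _ _ h (by omega); linarith
  have hkb : k + 1 ≤ b := by
    by_contra hc
    rcases (show b ≤ k by omega).eq_or_lt with h | h
    · rw [h] at h1; linarith
    · have := hx _ _ h (by omega); linarith
  have hz := orient_of_mem_segment (openSegment_subset_segment ℝ _ _ hq1)
  have e1 : orient (p a) (p a) (p b) = 0 := by simp [orient]
  have e2 : orient (p a) (p b) (p b) = 0 := by simp only [orient]; ring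
  have hne' : a < k ∨ k + 1 < b := by
    by_contra hc
    apply hne
    rw [Prod.mk.injEq]
    omega
  obtain ⟨s, t, hs0, ht0, hst, rfl⟩ := hq2
  rw [orient_combo _ _ _ _ _ _ hst] at hz
  have hz' : ∀ c : ℝ, s * (c * orient (p a) (p k) (p b)) +
      t * (c * orient (p a) (p (k + 1)) (p b)) = 0 := by
    intro c
    linear_combination c * hz
  have fin : ∀ c : ℝ, (∀ m, a < m → m < b → 0 < c * orient (p a) (p m) (p b)) → False := by
    intro c hc
    have hz := hz' c
    have w : ∀ m, a ≤ m → m ≤ b → 0 ≤ c * orient (p a) (p m) (p b) := by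
      intro m m1 m2
      rcases m1.eq_or_lt with rfl | m1
      · simp [e1]
      rcases m2.eq_or_lt with rfl | m2
      · simp [e2]
      exact (hc m m1 m2).le
    have w1 := mul_nonneg hs0.le (w k hak (by omega))
    have w2 := mul_nonneg ht0.le (w (k + 1) (by omega) hkb)
    rcases hne' with h | h
    · have := mul_pos hs0 (hc k h (by omega)); linarith
    · have := mul_pos ht0 (hc (k + 1) (by omega) h); linarith
  rcases hs a b hab hb with h | h
  · exact fin 1 (by simpa using h)
  · exact fin (-1) (by simpa using h)

theorem unavoidable_of_oneSided (hx : ∀ i j, i < j → j ≤ n → (p i).1 < (p j).1)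
    (hs : OneSided n p) : ∀ i, i < n → Unavoidable n p (i, i + 1) := by
  intro i hi G hG
  have hcf : CrossingFree n p (insert (i, i + 1) G) := by
    constructor
    · intro e he
      rcases Finset.mem_insert.1 he with rfl | he
      · exact mem_edges.2 ⟨by simp, by simpa using hi⟩
      · exact hG.prop.1 he
    · intro e he f hf
      rcases Finset.mem_insert.1 he with rfl | he <;> rcases Finset.mem_insert.1 hf with rfl | hf
      · exact fun h => h.1 rfl
      · intro h
        refine not_cross_of_oneSided hx hs hi (hG.prop.1 hf) ⟨h.1.symm, ?_⟩
        rw [Set.inter_comm]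
        exact h.2
      · exact not_cross_of_oneSided hx hs hi (hG.prop.1 he)
      · exact hG.prop.2 e he f hf
  exact hG.2 hcf (Finset.subset_insert _ _) (Finset.mem_insert_self _ _)

end

end PlanarChain

open PlanarChain

namespace Chain

/-- The chain on points with well-defined sides. -/
def ofOneSided (n : ℕ) (p : ℕ → ℝ × ℝ) (hx : ∀ i j, i < j → j ≤ n → (p i).1 < (p j).1)
    (hs : OneSided n p) : Chain :=
  ⟨n, p, hx, not_collinear_of_oneSided hx hs, unavoidable_of_oneSided hx hs⟩

theorem oneSided (C : Chain) : OneSided C.n C.p :=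
  oneSided_of_unavoidable C.x_lt C.not_collinear C.unavoidable

/-- The visibility triangle of a chain (entries with `i < j ≤ C.n`). -/
noncomputable def V (C : Chain) (i j : ℕ) : ℤ := visibility C.n C.p i j

theorem V_succ (C : Chain) (i : ℕ) : C.V i (i + 1) = 0 := by simp [V, visibility]

theorem V_eq_one (C : Chain) {i k j : ℕ} (hik : i < k) (hkj : k < j) (hj : j ≤ C.n)
    (h : 0 < orient (C.p i) (C.p k) (C.p j)) : C.V i j = 1 := by
  rcases C.oneSided i j (by omega) hj with h' | h'
  · have := (liesAbove_iff C.x_lt (show i < j by omega) hj).2 fun k h1 h2 => (h' k h1 h2).le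
    rw [V, visibility, if_neg (by omega), if_pos this]
  · exact absurd h (h' k hik hkj).not_gt

theorem V_eq_neg_one (C : Chain) {i k j : ℕ} (hik : i < k) (hkj : k < j) (hj : j ≤ C.n)
    (h : orient (C.p i) (C.p k) (C.p j) < 0) : C.V i j = -1 := by
  rcases C.oneSided i j (by omega) hj with h' | h'
  · exact absurd h (h' k hik hkj).not_gt
  · have h1 := (liesBelow_iff C.x_lt (show i < j by omega) hj).2 fun k h1 h2 => (h' k h1 h2).le
    have h2 : ¬ LiesAbove C.n C.p i j := fun h2 =>
      absurd h ((liesAbove_iff C.x_lt (show i < j by omega) hj).1 h2 k hik hkj).not_gt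
    rw [V, visibility, if_neg (by omega), if_neg h2, if_pos h1]

/-- Two entries of visibility triangles agree if the corresponding orientations agree. -/
theorem V_congr (C D : Chain) {i j a b k l : ℕ} (hik : i < k) (hkj : k < j) (hj : j ≤ C.n)
    (hal : a < l) (hlb : l < b) (hb : b ≤ D.n) {c : ℝ} (hc : 0 < c)
    (h : orient (C.p i) (C.p k) (C.p j) = c * orient (D.p a) (D.p l) (D.p b)) :
    C.V i j = D.V a b := by
  rcases D.oneSided a b (by omega) hb with h' | h'
  · rw [V_eq_one D hal hlb hb (h' l hal hlb), V_eq_one C hik hkj hj]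
    rw [h]
    exact mul_pos hc (h' l hal hlb)
  · rw [V_eq_neg_one D hal hlb hb (h' l hal hlb), V_eq_neg_one C hik hkj hj]
    rw [h]
    exact mul_neg_of_pos_of_neg hc (h' l hal hlb)

/-- The flipped version of a chain: its reflection at the `x`-axis. -/
def flip (C : Chain) : Chain :=
  ofOneSided C.n (fun i => ((C.p i).1, -(C.p i).2)) C.x_lt (by
    have ho : ∀ i k j, orient ((C.p i).1, -(C.p i).2) ((C.p k).1, -(C.p k).2)
        ((C.p j).1, -(C.p j).2) = - orient (C.p i) (C.p k) (C.p j) := by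
      intro i k j
      simp only [orient]
      ring
    intro i j hij hj
    simp only [ho]
    rcases C.oneSided i j hij hj with h | h
    · right
      intro k h1 h2
      linarith [h k h1 h2]
    · left
      intro k h1 h2
      linarith [h k h1 h2])

/-- Two chains `C₁`, `C₂` can be concatenated, after flattening them and arranging them in a
`∨`-shape (`s = 1`) or in a `∧`-shape (`s = -1`). -/
theorem exists_sum (s : ℤ) (hs : s = 1 ∨ s = -1) (C₁ C₂ : Chain) :
    ∃ C : Chain, C.n = C₁.n + C₂.n ∧ ∀ i j, i < j → j ≤ C₁.n + C₂.n →
      C.V i j =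
        if j ≤ C₁.n then C₁.V i j
        else if C₁.n ≤ i then C₂.V (i - C₁.n) (j - C₁.n)
        else s := by
  set n₁ := C₁.n with hn₁
  set n₂ := C₂.n with hn₂
  -- the points, up to flattening
  let X : ℕ → ℝ := fun i =>
    if i ≤ n₁ then (C₁.p i).1 - (C₁.p n₁).1 else (C₂.p (i - n₁)).1 - (C₂.p 0).1
  let Y : ℕ → ℝ := fun i =>
    if i ≤ n₁ then (C₁.p i).2 - (C₁.p n₁).2 else (C₂.p (i - n₁)).2 - (C₂.p 0).2
  let P : ℝ → ℕ → ℝ × ℝ := fun ε i => (X i, ε * Y i + s * |X i|)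
  have X1 : ∀ i, i ≤ n₁ → X i = (C₁.p i).1 - (C₁.p n₁).1 := fun i hi => if_pos hi
  have Y1 : ∀ i, i ≤ n₁ → Y i = (C₁.p i).2 - (C₁.p n₁).2 := fun i hi => if_pos hi
  have X2 : ∀ i, n₁ ≤ i → X i = (C₂.p (i - n₁)).1 - (C₂.p 0).1 := by
    intro i hi
    rcases hi.eq_or_lt with rfl | hi
    · simp [X]
    · exact if_neg (by omega)
  have Y2 : ∀ i, n₁ ≤ i → Y i = (C₂.p (i - n₁)).2 - (C₂.p 0).2 := by
    intro i hi
    rcases hi.eq_or_lt with rfl | hi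
    · simp [Y]
    · exact if_neg (by omega)
  have X0 : X n₁ = 0 := by simp [X]
  have Xl : ∀ i j, i < j → j ≤ n₁ + n₂ → X i < X j := by
    have h1 : ∀ i j, i < j → j ≤ n₁ → X i < X j := by
      intro i j hij hj
      rw [X1 i (by omega), X1 j hj]
      linarith [C₁.x_lt i j hij hj]
    have h2 : ∀ i j, i < j → n₁ ≤ i → j ≤ n₁ + n₂ → X i < X j := by
      intro i j hij hi hj
      rw [X2 i hi, X2 j (by omega)]
      linarith [C₂.x_lt (i - n₁) (j - n₁) (by omega) (by omega)]
    intro i j hij hj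
    rcases Nat.lt_or_ge n₁ j with hj' | hj'
    · rcases Nat.lt_or_ge i n₁ with hi | hi
      · exact (h1 i n₁ hi le_rfl).trans (h2 n₁ j hj' le_rfl hj)
      · exact h2 i j hij hi hj
    · exact h1 i j hij hj'
  have Xle : ∀ i, i ≤ n₁ → X i ≤ 0 := by
    intro i hi
    rcases hi.eq_or_lt with h | h
    · rw [h, X0]
    · rw [← X0]; exact (Xl i n₁ h (by omega)).le
  have Xge : ∀ i, n₁ ≤ i → i ≤ n₁ + n₂ → 0 ≤ X i := by
    intro i hi hi'
    rcases hi.eq_or_lt with h | h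
    · rw [← h, X0]
    · rw [← X0]; exact (Xl n₁ i h hi').le
  have s2 : (s : ℝ) * s = 1 := by rcases hs with rfl | rfl <;> norm_num
  -- orientations inside one block
  have o1 : ∀ ε i k j, i < k → k < j → j ≤ n₁ →
      orient (P ε i) (P ε k) (P ε j) = ε * orient (C₁.p i) (C₁.p k) (C₁.p j) := by
    intro ε i k j hik hkj hj
    simp only [P, orient, abs_of_nonpos (Xle i (by omega)), abs_of_nonpos (Xle k (by omega)),
      abs_of_nonpos (Xle j hj)]
    rw [X1 i (by omega), X1 k (by omega), X1 j hj, Y1 i (by omega), Y1 k (by omega), Y1 j hj]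
    ring
  have o2 : ∀ ε i k j, i < k → k < j → n₁ ≤ i → j ≤ n₁ + n₂ →
      orient (P ε i) (P ε k) (P ε j) =
        ε * orient (C₂.p (i - n₁)) (C₂.p (k - n₁)) (C₂.p (j - n₁)) := by
    intro ε i k j hik hkj hi hj
    simp only [P, orient, abs_of_nonneg (Xge i hi (by omega)),
      abs_of_nonneg (Xge k (by omega) (by omega)), abs_of_nonneg (Xge j (by omega) hj)]
    rw [X2 i (by omega), X2 k (by omega), X2 j (by omega), Y2 i (by omega), Y2 k (by omega),
      Y2 j (by omega)]
    ring
  -- orientations between the two blocks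
  have o3 : ∀ i k j, i < k → k < j → i < n₁ → n₁ < j → j ≤ n₁ + n₂ →
      ∀ᶠ ε in nhdsWithin (0 : ℝ) (Set.Ioi 0), 0 < s * orient (P ε i) (P ε k) (P ε j) := by
    intro i k j hik hkj hi hj hj'
    have hcont : Continuous fun ε : ℝ => s * orient (P ε i) (P ε k) (P ε j) := by
      simp only [P, orient]
      fun_prop
    have h0 : 0 < s * orient (P 0 i) (P 0 k) (P 0 j) := by
      have a1 := Xl i k hik (by omega)
      have a2 := Xl k j hkj hj'
      have a3 : X i < 0 := by rw [← X0]; exact Xl i n₁ hi (by omega)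
      have a4 : 0 < X j := by rw [← X0]; exact Xl n₁ j hj hj'
      have e : (s : ℝ) * orient (P 0 i) (P 0 k) (P 0 j) =
          (s * s) * ((X k - X i) * (|X j| - |X i|) - (|X k| - |X i|) * (X j - X i)) := by
        simp only [P, orient]
        ring
      rw [e, s2, abs_of_neg a3, abs_of_pos a4]
      rcases le_total 0 (X k) with h | h
      · rw [abs_of_nonneg h]; nlinarith
      · rw [abs_of_nonpos h]; nlinarith
    exact (hcont.continuousAt.eventually_const_lt h0).filter_mono nhdsWithin_le_nhds
  have ev : ∀ᶠ ε in nhdsWithin (0 : ℝ) (Set.Ioi 0),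
      ∀ i ∈ Finset.range (n₁ + n₂ + 1), ∀ k ∈ Finset.range (n₁ + n₂ + 1),
      ∀ j ∈ Finset.range (n₁ + n₂ + 1), i < k → k < j → i < n₁ → n₁ < j →
      0 < s * orient (P ε i) (P ε k) (P ε j) := by
    simp only [Filter.eventually_all_finset]
    intro i _ k _ j hj
    simp only [Filter.eventually_imp_distrib_left]
    intro h1 h2 h3 h4
    rw [Finset.mem_range] at hj
    exact o3 i k j h1 h2 h3 h4 (by omega)
  obtain ⟨ε, hε, hε0⟩ := (ev.and self_mem_nhdsWithin).exists
  replace hε0 : 0 < ε := hε0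
  have o3' : ∀ i k j, i < k → k < j → i < n₁ → n₁ < j → j ≤ n₁ + n₂ →
      0 < s * orient (P ε i) (P ε k) (P ε j) := by
    intro i k j h1 h2 h3 h4 h5
    exact hε i (by simp; omega) k (by simp; omega) j (by simp; omega) h1 h2 h3 h4
  have hos : OneSided (n₁ + n₂) (P ε) := by
    intro i j hij hj
    rcases Nat.lt_or_ge n₁ j with hj' | hj'
    · rcases Nat.lt_or_ge i n₁ with hi | hi
      · rcases hs with rfl | rfl
        · left
          intro k h1 h2
          simpa using o3' i k j h1 h2 hi hj' hj
        · right
          intro k h1 h2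
          simpa using o3' i k j h1 h2 hi hj' hj
      · rcases C₂.oneSided (i - n₁) (j - n₁) (by omega) (by omega) with h | h
        · left
          intro k h1 h2
          rw [o2 ε i k j h1 h2 hi hj]
          exact mul_pos hε0 (h _ (by omega) (by omega))
        · right
          intro k h1 h2
          rw [o2 ε i k j h1 h2 hi hj]
          exact mul_neg_of_pos_of_neg hε0 (h _ (by omega) (by omega))
    · rcases C₁.oneSided i j hij hj' with h | h
      · left
        intro k h1 h2
        rw [o1 ε i k j h1 h2 hj']
        exact mul_pos hε0 (h k h1 h2)
      · right
        intro k h1 h2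
        rw [o1 ε i k j h1 h2 hj']
        exact mul_neg_of_pos_of_neg hε0 (h k h1 h2)
  refine ⟨ofOneSided (n₁ + n₂) (P ε) Xl hos, rfl, ?_⟩
  intro i j hij hj
  rcases (show i + 1 ≤ j from hij).eq_or_lt with rfl | hlt
  · rw [V_succ]
    split_ifs with h1 h2
    · rw [V_succ]
    · rw [show i + 1 - n₁ = i - n₁ + 1 by omega, V_succ]
    · omega
  · split_ifs with h1 h2
    · exact V_congr _ C₁ (Nat.lt_succ_self i) hlt hj (Nat.lt_succ_self i) hlt h1 hε0
        (o1 ε i (i + 1) j (Nat.lt_succ_self i) hlt h1)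
    · exact V_congr _ C₂ (Nat.lt_succ_self i) hlt hj (a := i - n₁) (l := i + 1 - n₁)
        (b := j - n₁) (by omega) (by omega) (by omega) hε0
        (o2 ε i (i + 1) j (Nat.lt_succ_self i) hlt h2 hj)
    · have := o3' i (i + 1) j (Nat.lt_succ_self i) hlt (by omega) (by omega) hj
      rcases hs with rfl | rfl
      · refine V_eq_one _ (Nat.lt_succ_self i) hlt hj ?_
        simpa [ofOneSided] using this
      · refine V_eq_neg_one _ (Nat.lt_succ_self i) hlt hj ?_
        simpa [ofOneSided] using this

/-- The convex sum `C₁ ∨ C₂`: a chain with `C₁.n + C₂.n` chain edges whose visibility triangle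
restricts to those of `C₁` and `C₂` and is `+1` at all `i < C₁.n < j`. -/
noncomputable def convexSum (C₁ C₂ : Chain) : Chain :=
  (exists_sum 1 (Or.inl rfl) C₁ C₂).choose

/-- The concave sum `C₁ ∧ C₂`: a chain with `C₁.n + C₂.n` chain edges whose visibility triangle
restricts to those of `C₁` and `C₂` and is `-1` at all `i < C₁.n < j`. -/
noncomputable def concaveSum (C₁ C₂ : Chain) : Chain :=
  (exists_sum (-1) (Or.inr rfl) C₁ C₂).choose

/-- Chains are considered equal if they have the same visibility triangle. -/
def Same (C D : Chain) : Prop :=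
  C.n = D.n ∧ ∀ i j, i < j → j ≤ C.n → C.V i j = D.V i j

/-! ### Counting triangulations -/

/-- The number `tr(C)` of (complete) triangulations of a chain. -/
noncomputable def tr (C : Chain) : ℕ :=
  Set.ncard {G : Finset (ℕ × ℕ) | IsTriangulation C.n C.p G}

/-- An upper triangulation: a crossing-free geometric graph that is edge-maximal subject to only
containing chain edges and upper edges. -/
def IsUpperTriangulation (C : Chain) (G : Finset (ℕ × ℕ)) : Prop :=
  Maximal (fun H => CrossingFree C.n C.p H ∧ ∀ e ∈ H, C.V e.1 e.2 = 0 ∨ C.V e.1 e.2 = 1) G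

/-- The number `U(C)` of upper triangulations of a chain. -/
noncomputable def U (C : Chain) : ℕ :=
  Set.ncard {G : Finset (ℕ × ℕ) | C.IsUpperTriangulation G}

/-! ### Sums of copies of one chain -/

/-- The convex sum of `k + 1` copies of `C`. -/
noncomputable def convexPower (C : Chain) : ℕ → Chain
  | 0 => C
  | k + 1 => (convexPower C k).convexSum C

/-- The poly-`C₀` chain: the convex sum of `N ≥ 1` copies of the flipped version of `C₀`. -/
noncomputable def poly (C₀ : Chain) (N : ℕ) : Chain :=
  C₀.flip.convexPower (N - 1)

end Chain

/-- Formulas built from convex sums, concave sums and copies of one fixed chain. -/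
inductive SumFormula where
  | copy : SumFormula
  | convex : SumFormula → SumFormula → SumFormula
  | concave : SumFormula → SumFormula → SumFormula

namespace SumFormula

/-- The number of copies of the fixed chain that a formula uses. -/
def copies : SumFormula → ℕ
  | copy => 1
  | convex F G => F.copies + G.copies
  | concave F G => F.copies + G.copies

/-- The chain that a formula describes when the fixed chain is `C₀`. -/
noncomputable def eval (C₀ : Chain) : SumFormula → Chain
  | copy => C₀
  | convex F G => (F.eval C₀).convexSum (G.eval C₀)
  | concave F G => (F.eval C₀).concaveSum (G.eval C₀)

end SumFormula

/-! Because chain edges are unavoidable, the points strictly between `p i` and `p j` all lie on one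
side of the edge `p i p j` (`Chain.oneSided`). Hence two edges can cross only if their index
intervals interleave, and interleaving edges cross exactly when they lie on the same side of the
curve. Chain edges interleave with nothing. A triangulation is therefore an independent choice of a
maximal non-interleaving family above and one below the curve: `tr` is the product of two side
counts (`Chain.tr_eq_mul`), each determined by the visibility triangle alone.

Both bounds then follow from one monotonicity principle, `ncard_maximalConflictFree_mono`: enlarging
the set of admissible edges cannot decrease the number of maximal conflict-free families.

Lower bound: on either side, the admissible edges of a sum include those of both summands, and edges
of different summands never interleave, so side counts are supermultiplicative
(`Chain.IsSum.mul_sideCount_le`). Induction on the formula finishes.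

Upper bound: in `C` each of the `N` consecutive blocks looks like `C₀`, whatever the formula. Making
every edge between blocks an upper edge only adds admissible edges above the curve, and the result
is a convex power of `C₀`. The lower side is treated in the same way after a flip, which gives a
convex power of `C₀.flip` (`Chain.HasBlocks.sideCount_le`). -/

/-! ### Maximal conflict-free sets -/

section ConflictFree

variable {α β : Type*}

/-- `H` is a subset of `A` without two elements in conflict. -/
def ConflictFree (R : α → α → Prop) (A H : Finset α) : Prop :=
  H ⊆ A ∧ ∀ e ∈ H, ∀ f ∈ H, ¬ R e f

/-- The set of maximal conflict-free subsets of `A`. -/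
def maximalConflictFree (R : α → α → Prop) (A : Finset α) : Set (Finset α) :=
  {H | Maximal (ConflictFree R A) H}

theorem finite_maximalConflictFree (R : α → α → Prop) (A : Finset α) :
    (maximalConflictFree R A).Finite :=
  A.powerset.finite_toSet.subset fun H hH => by simpa using hH.prop.1

theorem ConflictFree.exists_maximal {R : α → α → Prop} {A H : Finset α}
    (hH : ConflictFree R A H) : ∃ T, H ⊆ T ∧ Maximal (ConflictFree R A) T := by
  have hfin : {H | ConflictFree R A H}.Finite :=
    A.powerset.finite_toSet.subset fun H hH => by simpa using hH.1
  obtain ⟨T, hT, hm⟩ := hfin.exists_le_maximal hH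
  exact ⟨T, hT, hm⟩

theorem ConflictFree.mono {R : α → α → Prop} {A B H K : Finset α}
    (hH : ConflictFree R A H) (hKH : K ⊆ H) (hKB : K ⊆ B) : ConflictFree R B K :=
  ⟨hKB, fun e he f hf => hH.2 e (hKH he) f (hKH hf)⟩

theorem maximalConflictFree_congr {R S : α → α → Prop} {A : Finset α}
    (h : ∀ e ∈ A, ∀ f ∈ A, (R e f ↔ S e f)) :
    maximalConflictFree R A = maximalConflictFree S A := by
  have : ConflictFree R A = ConflictFree S A := by
    funext H
    refine propext (and_congr_right fun hA => ?_)
    exact forall₂_congr fun e he => forall₂_congr fun f hf => not_congr (h e (hA he) f (hA hf))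
  simp only [maximalConflictFree, this]

/-- Extend a maximal `H` in `A` to a maximal `T` in `B`. Then `T ∩ A` is conflict-free and contains
`H`, so it equals `H`, and `H` can be recovered from `T`. A general `T` may have a non-maximal trace
on `A`, so the traces merely cover the family for `A`. -/
theorem ncard_maximalConflictFree_mono [DecidableEq α] {R : α → α → Prop} {A B : Finset α} (h : A ⊆ B) :
    (maximalConflictFree R A).ncard ≤ (maximalConflictFree R B).ncard := by
  have ex : ∀ H, H ∈ maximalConflictFree R A →
      ∃ T ∈ maximalConflictFree R B, T ∩ A = H := by
    intro H hH
    obtain ⟨T, hHT, hT⟩ := (hH.prop.mono subset_rfl (hH.prop.1.trans h)).exists_maximal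
    refine ⟨T, hT, ?_⟩
    have hsub : H ⊆ T ∩ A := Finset.subset_inter hHT hH.prop.1
    exact (hH.eq_of_le (hT.prop.mono Finset.inter_subset_left Finset.inter_subset_right)
      hsub).symm
  have hsub : maximalConflictFree R A ⊆ (fun T => T ∩ A) '' maximalConflictFree R B :=
    fun H hH => ex H hH
  exact (Set.ncard_le_ncard hsub ((finite_maximalConflictFree R B).image _)).trans
    (Set.ncard_image_le (finite_maximalConflictFree R B))

/-- The bijection is `G ↦ (G ∩ A, G ∩ B)` with inverse the union. Disjointness of `A` and `B` is not
needed: a common element conflicts with nothing, so it lies in every maximal set. This matters for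
the two sides of a chain, which share the chain edges. -/
theorem ncard_maximalConflictFree_union [DecidableEq α] {R : α → α → Prop} (hR : ∀ e f, R e f → R f e)
    {A B : Finset α} (h : ∀ e ∈ A, ∀ f ∈ B, ¬ R e f) :
    (maximalConflictFree R (A ∪ B)).ncard =
      (maximalConflictFree R A).ncard * (maximalConflictFree R B).ncard := by
  have glue : ∀ H K, ConflictFree R A H → ConflictFree R B K →
      ConflictFree R (A ∪ B) (H ∪ K) := by
    intro H K hH hK
    refine ⟨Finset.union_subset_union hH.1 hK.1, ?_⟩
    intro e he f hf
    rcases Finset.mem_union.1 he with he | he <;> rcases Finset.mem_union.1 hf with hf | hf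
    · exact hH.2 e he f hf
    · exact h e (hH.1 he) f (hK.1 hf)
    · exact fun hr => h f (hH.1 hf) e (hK.1 he) (hR _ _ hr)
    · exact hK.2 e he f hf
  have split : ∀ G, G ⊆ A ∪ B → (G ∩ A) ∪ (G ∩ B) = G := fun G hG => by
    rw [← Finset.inter_union_distrib_left, Finset.inter_eq_left.2 hG]
  rw [← Set.ncard_prod]
  refine Set.ncard_congr (fun G _ => (G ∩ A, G ∩ B)) ?_ ?_ ?_
  · intro G hG
    have hA := hG.prop.mono (K := G ∩ A) (B := A) Finset.inter_subset_left
      Finset.inter_subset_right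
    have hB := hG.prop.mono (K := G ∩ B) (B := B) Finset.inter_subset_left
      Finset.inter_subset_right
    refine ⟨⟨hA, fun H hH hle => ?_⟩, ⟨hB, fun H hH hle => ?_⟩⟩
    · have := hG.le_of_ge (glue _ _ hH hB) (by
        conv_lhs => rw [← split G hG.prop.1]
        exact Finset.union_subset_union hle subset_rfl)
      exact Finset.subset_inter (Finset.subset_union_left.trans this) hH.1
    · have := hG.le_of_ge (glue _ _ hA hH) (by
        conv_lhs => rw [← split G hG.prop.1]
        exact Finset.union_subset_union subset_rfl hle)
      exact Finset.subset_inter (Finset.subset_union_right.trans this) hH.1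
  · intro G G' hG hG' heq
    rw [Prod.mk.injEq] at heq
    rw [← split G hG.prop.1, ← split G' hG'.prop.1, heq.1, heq.2]
  · rintro ⟨H, K⟩ ⟨hH, hK⟩
    simp only at hH hK
    have hHK := glue H K hH.prop hK.prop
    have eA : (H ∪ K) ∩ A = H := (hH.eq_of_le
      (hHK.mono Finset.inter_subset_left Finset.inter_subset_right)
      (Finset.subset_inter Finset.subset_union_left hH.prop.1)).symm
    have eB : (H ∪ K) ∩ B = K := (hK.eq_of_le
      (hHK.mono Finset.inter_subset_left Finset.inter_subset_right)
      (Finset.subset_inter Finset.subset_union_right hK.prop.1)).symm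
    refine ⟨H ∪ K, ⟨hHK, fun G hG hle => ?_⟩, Prod.ext eA eB⟩
    have h1 := hH.le_of_ge (hG.mono (K := G ∩ A) Finset.inter_subset_left
      Finset.inter_subset_right)
      (Finset.subset_inter (Finset.subset_union_left.trans hle) hH.prop.1)
    have h2 := hK.le_of_ge (hG.mono (K := G ∩ B) Finset.inter_subset_left
      Finset.inter_subset_right)
      (Finset.subset_inter (Finset.subset_union_right.trans hle) hK.prop.1)
    change G ⊆ H ∪ K
    rw [← split G hG.1]
    exact Finset.union_subset_union h1 h2

theorem ncard_maximalConflictFree_map_le {R : α → α → Prop} {S : β → β → Prop} (g : α ↪ β)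
    (hg : ∀ e f, S (g e) (g f) ↔ R e f) (A : Finset α) :
    (maximalConflictFree R A).ncard ≤ (maximalConflictFree S (A.map g)).ncard := by
  have hcf : ∀ H, ConflictFree S (A.map g) (H.map g) ↔ ConflictFree R A H := by
    intro H
    simp [ConflictFree, hg]
  refine Set.ncard_le_ncard_of_injOn (fun H => H.map g) ?_
    (Finset.map_injective g).injOn (finite_maximalConflictFree _ _)
  intro H hH
  refine ⟨(hcf H).2 hH.prop, fun K hK hle => ?_⟩
  obtain ⟨K, -, rfl⟩ := Finset.subset_map_iff.1 hK.1
  exact Finset.map_subset_map.2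
    (hH.le_of_ge ((hcf K).1 hK) (Finset.map_subset_map.1 hle))

end ConflictFree

/-! ### Crossings in a chain -/

namespace PlanarChain

/-- The index intervals of two edges interleave. -/
def Interleave (e f : ℕ × ℕ) : Prop :=
  (e.1 < f.1 ∧ f.1 < e.2 ∧ e.2 < f.2) ∨ (f.1 < e.1 ∧ e.1 < f.2 ∧ f.2 < e.2)

theorem Interleave.symm {e f : ℕ × ℕ} (h : Interleave e f) : Interleave f e := Or.symm h

theorem Cross.symm {p : ℕ → ℝ × ℝ} {e f : ℕ × ℕ} (h : Cross p e f) : Cross p f e :=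
  ⟨h.1.symm, by rw [Set.inter_comm]; exact h.2⟩

section

variable {n : ℕ} {p : ℕ → ℝ × ℝ}

/-- Both `p k` and `p l` lie weakly on one side of the line through `p a` and `p b`, and at least
one lies strictly there, so the open segment between them misses that line. -/
theorem not_cross_of_nested (hs : OneSided n p) {a b k l : ℕ} (hak : a ≤ k) (hkl : k < l) (hlb : l ≤ b) (hb : b ≤ n) :
    ¬ Cross p (a, b) (k, l) := by
  rintro ⟨hne, q, hq1, hq2⟩
  simp only at hq1 hq2
  have hz := orient_of_mem_segment (openSegment_subset_segment ℝ _ _ hq1)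
  have e1 : orient (p a) (p a) (p b) = 0 := by simp [orient]
  have e2 : orient (p a) (p b) (p b) = 0 := by simp only [orient]; ring
  have hne' : a < k ∨ l < b := by
    by_contra hc
    apply hne
    rw [Prod.mk.injEq]
    omega
  obtain ⟨s, t, hs0, ht0, hst, rfl⟩ := hq2
  rw [orient_combo _ _ _ _ _ _ hst] at hz
  -- The factor `c = ±1` handles both sides of the edge with one argument.
  have fin : ∀ c : ℝ, (∀ m, a < m → m < b → 0 < c * orient (p a) (p m) (p b)) → False := by
    intro c hc
    have hz : s * (c * orient (p a) (p k) (p b)) + t * (c * orient (p a) (p l) (p b)) = 0 := by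
      linear_combination c * hz
    have w : ∀ m, a ≤ m → m ≤ b → 0 ≤ c * orient (p a) (p m) (p b) := by
      intro m m1 m2
      rcases m1.eq_or_lt with rfl | m1
      · simp [e1]
      rcases m2.eq_or_lt with rfl | m2
      · simp [e2]
      exact (hc m m1 m2).le
    have w1 := mul_nonneg hs0.le (w k hak (by omega))
    have w2 := mul_nonneg ht0.le (w l (by omega) hlb)
    rcases hne' with h | h
    · have := mul_pos hs0 (hc k h (by omega)); linarith
    · have := mul_pos ht0 (hc l (by omega) h); linarith
  rcases hs a b (by omega) hb with h | h
  · exact fin 1 (by simpa using h)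
  · exact fin (-1) (by simpa using h)

theorem not_cross_of_disjoint (hx : ∀ i j, i < j → j ≤ n → (p i).1 < (p j).1)
    {a b k l : ℕ} (hab : a < b) (hbk : b ≤ k) (hkl : k < l) (hl : l ≤ n) :
    ¬ Cross p (a, b) (k, l) := by
  rintro ⟨-, q, hq1, hq2⟩
  have h1 := fst_mem_Ioo (hx a b hab (by omega)) hq1
  have h2 := fst_mem_Ioo (hx k l hkl hl) hq2
  rcases hbk.eq_or_lt with rfl | h
  · linarith
  · have := hx b k h (by omega); linarith

/-- Edges without interleaving index intervals do not cross. -/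
theorem Cross.interleave (hx : ∀ i j, i < j → j ≤ n → (p i).1 < (p j).1) (hs : OneSided n p)
    {e f : ℕ × ℕ} (he : e ∈ edges n) (hf : f ∈ edges n) (h : Cross p e f) : Interleave e f := by
  obtain ⟨a, b⟩ := e
  obtain ⟨k, l⟩ := f
  rw [mem_edges] at he hf
  simp only at he hf
  by_contra hn
  simp only [Interleave] at hn
  have : (a ≤ k ∧ l ≤ b) ∨ (k ≤ a ∧ b ≤ l) ∨ b ≤ k ∨ l ≤ a := by omega
  rcases this with ⟨h1, h2⟩ | ⟨h1, h2⟩ | h1 | h1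
  · exact not_cross_of_nested hs h1 hf.1 h2 he.2 h
  · exact not_cross_of_nested hs h1 he.1 h2 hf.2 h.symm
  · exact not_cross_of_disjoint hx he.1 h1 hf.1 hf.2 h
  · exact not_cross_of_disjoint hx hf.1 h1 he.1 he.2 h.symm

/-- The difference of the heights of the edges `a b` and `k l` is interpolated linearly between the
abscissas of `k` and `b`. -/
theorem height_sub {a b k l q r : ℝ × ℝ} (hq : orient a q b = 0) (hr : orient k r l = 0)
    (hqr : q.1 = r.1) : (b.1 - k.1) * (q.2 - r.2) * ((b.1 - a.1) * (l.1 - k.1)) =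
      (l.1 - k.1) * (b.1 - r.1) * orient a k b - (b.1 - a.1) * (r.1 - k.1) * orient k b l := by
  simp only [orient] at *
  rw [hqr] at hq
  linear_combination (-(b.1 - k.1) * (l.1 - k.1)) * hq + ((b.1 - k.1) * (b.1 - a.1)) * hr

/-- Interleaving edges on the same side of the curve cross. -/
theorem cross_of_interleave (hx : ∀ i j, i < j → j ≤ n → (p i).1 < (p j).1)
    {a k b l : ℕ} (hak : a < k) (hkb : k < b) (hbl : b < l) (hl : l ≤ n) {s : ℝ}
    (h1 : 0 < s * orient (p a) (p k) (p b)) (h2 : 0 < s * orient (p k) (p b) (p l)) :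
    Cross p (a, b) (k, l) := by
  refine ⟨fun h => ?_, ?_⟩
  · rw [Prod.mk.injEq] at h
    omega
  have x1 := hx a k hak (by omega)
  have x2 := hx k b hkb (by omega)
  have x3 := hx b l hbl hl
  have hD1 : 0 < (p b).1 - (p a).1 := by linarith
  have hD2 : 0 < (p l).1 - (p k).1 := by linarith
  set α := ((p l).1 - (p k).1) * (s * orient (p a) (p k) (p b)) with hα
  set β := ((p b).1 - (p a).1) * (s * orient (p k) (p b) (p l)) with hβ
  have hα0 : 0 < α := mul_pos hD2 h1
  have hβ0 : 0 < β := mul_pos hD1 h2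
  -- By `height_sub`, the height difference of the two edges at abscissa `x`, times `s`, is a
  -- positive multiple of `α * ((p b).1 - x) - β * (x - (p k).1)`. The chosen `x` is its zero, a
  -- weighted mean of the two abscissas.
  obtain ⟨x, hxk, hxb, hxe⟩ : ∃ x, (p k).1 < x ∧ x < (p b).1 ∧
      α * ((p b).1 - x) = β * (x - (p k).1) := by
    refine ⟨(α * (p b).1 + β * (p k).1) / (α + β), ?_, ?_, ?_⟩
    · rw [lt_div_iff₀ (by positivity)]; nlinarith
    · rw [div_lt_iff₀ (by positivity)]; nlinarith
    · field_simp; ring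
  obtain ⟨q, hq, hqx⟩ := exists_mem_segment (a := p a) (c := p b) (x := x) (by linarith) hxb
  obtain ⟨r, hr, hrx⟩ := exists_mem_segment (a := p k) (c := p l) (x := x) hxk (by linarith)
  have hh := height_sub (orient_of_mem_segment (openSegment_subset_segment ℝ _ _ hq))
    (orient_of_mem_segment (openSegment_subset_segment ℝ _ _ hr)) (hqx.trans hrx.symm)
  rw [hrx] at hh
  have hs : s ≠ 0 := by rintro rfl; simp at h1
  have h0 : (s * (((p b).1 - (p k).1) * (((p b).1 - (p a).1) * ((p l).1 - (p k).1)))) *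
      (q.2 - r.2) = 0 := by
    linear_combination s * hh + hxe
  have hy : q.2 - r.2 = 0 := (mul_eq_zero.1 h0).resolve_left (mul_ne_zero hs
    (mul_pos (sub_pos.2 x2) (mul_pos hD1 hD2)).ne')
  have hqr : q = r := Prod.ext (hqx.trans hrx.symm) (by linarith)
  exact ⟨q, hq, hqr ▸ hr⟩

/-- Interleaving edges on different sides of the curve do not cross. -/
theorem not_cross_of_interleave (hx : ∀ i j, i < j → j ≤ n → (p i).1 < (p j).1)
    {a k b l : ℕ} (hak : a < k) (hkb : k < b) (hbl : b < l) (hl : l ≤ n) {s : ℝ}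
    (h1 : 0 < s * orient (p a) (p k) (p b)) (h2 : s * orient (p k) (p b) (p l) < 0) :
    ¬ Cross p (a, b) (k, l) := by
  rintro ⟨-, q, hq1, hq2⟩
  have hD1 : 0 < (p b).1 - (p a).1 := sub_pos.2 (hx a b (by omega) (by omega))
  have hD2 : 0 < (p l).1 - (p k).1 := sub_pos.2 (hx k l (by omega) hl)
  have hb := (fst_mem_Ioo (sub_pos.1 hD1) hq1).2
  have hk := (fst_mem_Ioo (sub_pos.1 hD2) hq2).1
  -- At a common point the height difference is zero, while the opposite signs of the orientations
  -- make `s` times the right-hand side of `height_sub` strictly positive.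
  have hh := height_sub (orient_of_mem_segment (openSegment_subset_segment ℝ _ _ hq1))
    (orient_of_mem_segment (openSegment_subset_segment ℝ _ _ hq2)) rfl
  have t1 := mul_pos (mul_pos hD2 (sub_pos.2 hb)) h1
  have t2 := mul_neg_of_pos_of_neg (mul_pos hD1 (sub_pos.2 hk)) h2
  simp only [sub_self, mul_zero, zero_mul] at hh
  have : s * (((p l).1 - (p k).1) * ((p b).1 - q.1) * orient (p a) (p k) (p b) -
      ((p b).1 - (p a).1) * (q.1 - (p k).1) * orient (p k) (p b) (p l)) = 0 := by
    rw [← hh, mul_zero]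
  linarith

end

end PlanarChain

/-! ### Upper and lower triangulations -/

namespace Chain

open Classical in
/-- The edges of a chain that are chain edges or have the entry `s` in the visibility triangle. -/
noncomputable def sideEdges (s : ℤ) (C : Chain) : Finset (ℕ × ℕ) :=
  (edges C.n).filter fun e => C.V e.1 e.2 = 0 ∨ C.V e.1 e.2 = s

/-- The number of triangulations of one side of a chain. -/
noncomputable def sideCount (s : ℤ) (C : Chain) : ℕ :=
  (maximalConflictFree Interleave (C.sideEdges s)).ncard

theorem mem_sideEdges {s : ℤ} {C : Chain} {i j : ℕ} : (i, j) ∈ C.sideEdges s ↔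
    (i < j ∧ j ≤ C.n) ∧ (C.V i j = 0 ∨ C.V i j = s) := by
  simp [sideEdges, mem_edges]

theorem V_cases (C : Chain) {i j : ℕ} (hij : i < j) (hj : j ≤ C.n) :
    j = i + 1 ∨
    (i + 1 < j ∧ C.V i j = 1 ∧ ∀ k, i < k → k < j → 0 < orient (C.p i) (C.p k) (C.p j)) ∨
    (i + 1 < j ∧ C.V i j = -1 ∧ ∀ k, i < k → k < j → orient (C.p i) (C.p k) (C.p j) < 0) := by
  rcases (show i + 1 ≤ j from hij).eq_or_lt with h | h
  · exact Or.inl h.symm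
  · right
    rcases C.oneSided i j hij hj with h' | h'
    · exact Or.inl ⟨h, C.V_eq_one (Nat.lt_succ_self i) h hj (h' _ (Nat.lt_succ_self i) h), h'⟩
    · exact Or.inr ⟨h, C.V_eq_neg_one (Nat.lt_succ_self i) h hj (h' _ (Nat.lt_succ_self i) h), h'⟩

theorem V_mem (C : Chain) {i j : ℕ} (hij : i < j) (hj : j ≤ C.n) :
    C.V i j = 0 ∨ C.V i j = 1 ∨ C.V i j = -1 := by
  rcases C.V_cases hij hj with rfl | h | h
  · exact Or.inl (C.V_succ i)
  · exact Or.inr (Or.inl h.2.1)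
  · exact Or.inr (Or.inr h.2.1)

/-- An index strictly between `i` and `j` rules out a chain edge, so the entry must be `s`, which is
also the sign of the orientation. -/
theorem mul_orient_pos (C : Chain) {s : ℤ} (hs : s = 1 ∨ s = -1) {i k j : ℕ} (hik : i < k)
    (hkj : k < j) (hj : j ≤ C.n) (h : C.V i j = 0 ∨ C.V i j = s) :
    0 < (s : ℝ) * orient (C.p i) (C.p k) (C.p j) := by
  rcases C.V_cases (hik.trans hkj) hj with h' | ⟨-, h', ho⟩ | ⟨-, h', ho⟩
  · omega
  · obtain rfl : s = 1 := by omega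
    simpa using ho k hik hkj
  · obtain rfl : s = -1 := by omega
    simpa using ho k hik hkj

theorem V_flip (C : Chain) {i j : ℕ} (hij : i < j) (hj : j ≤ C.n) :
    C.flip.V i j = - C.V i j := by
  have ho : ∀ k, orient (C.flip.p i) (C.flip.p k) (C.flip.p j) =
      - orient (C.p i) (C.p k) (C.p j) := by
    intro k
    simp only [flip, ofOneSided, orient]
    ring
  rcases C.V_cases hij hj with rfl | ⟨h, h', hk⟩ | ⟨h, h', hk⟩
  · simp [V_succ]
  · rw [h', C.flip.V_eq_neg_one (Nat.lt_succ_self i) h hj]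
    rw [ho]
    linarith [hk _ (Nat.lt_succ_self i) h]
  · rw [h', C.flip.V_eq_one (Nat.lt_succ_self i) h hj, neg_neg]
    rw [ho]
    linarith [hk _ (Nat.lt_succ_self i) h]

/-- Within one side the geometry reduces to the combinatorics of indices: each of two interleaving
edges has an endpoint of the other inside its index interval, so neither is a chain edge and both
have entry `s`. -/
theorem cross_iff_interleave (C : Chain) {s : ℤ} (hs : s = 1 ∨ s = -1) {e f : ℕ × ℕ}
    (he : e ∈ C.sideEdges s) (hf : f ∈ C.sideEdges s) : Cross C.p e f ↔ Interleave e f := by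
  obtain ⟨a, b⟩ := e
  obtain ⟨k, l⟩ := f
  rw [mem_sideEdges] at he hf
  constructor
  · exact Cross.interleave C.x_lt C.oneSided (mem_edges.2 he.1) (mem_edges.2 hf.1)
  · rintro (⟨h1, h2, h3⟩ | ⟨h1, h2, h3⟩)
    · exact cross_of_interleave C.x_lt h1 h2 h3 hf.1.2
        (C.mul_orient_pos hs h1 h2 he.1.2 he.2) (C.mul_orient_pos hs h2 h3 hf.1.2 hf.2)
    · exact (cross_of_interleave C.x_lt h1 h2 h3 he.1.2
        (C.mul_orient_pos hs h1 h2 hf.1.2 hf.2) (C.mul_orient_pos hs h2 h3 he.1.2 he.2)).symm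

theorem not_cross_of_sides (C : Chain) {e f : ℕ × ℕ}
    (he : e ∈ C.sideEdges 1) (hf : f ∈ C.sideEdges (-1)) : ¬ Cross C.p e f := by
  obtain ⟨a, b⟩ := e
  obtain ⟨k, l⟩ := f
  rw [mem_sideEdges] at he hf
  intro h
  rcases Cross.interleave C.x_lt C.oneSided (mem_edges.2 he.1) (mem_edges.2 hf.1) h with
    ⟨h1, h2, h3⟩ | ⟨h1, h2, h3⟩
  · have t1 := C.mul_orient_pos (Or.inl rfl) h1 h2 he.1.2 he.2
    have t2 := C.mul_orient_pos (Or.inr rfl) h2 h3 hf.1.2 hf.2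
    push_cast at t1 t2
    exact not_cross_of_interleave C.x_lt h1 h2 h3 hf.1.2 t1 (by linarith) h
  · have t1 := C.mul_orient_pos (Or.inr rfl) h1 h2 hf.1.2 hf.2
    have t2 := C.mul_orient_pos (Or.inl rfl) h2 h3 he.1.2 he.2
    push_cast at t1 t2
    exact not_cross_of_interleave C.x_lt h1 h2 h3 he.1.2 t1 (by linarith) h.symm

theorem maximalConflictFree_cross (C : Chain) {s : ℤ} (hs : s = 1 ∨ s = -1) :
    maximalConflictFree (Cross C.p) (C.sideEdges s) =
      maximalConflictFree Interleave (C.sideEdges s) :=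
  maximalConflictFree_congr fun _ he _ hf => C.cross_iff_interleave hs he hf

theorem sideEdges_union (C : Chain) : C.sideEdges 1 ∪ C.sideEdges (-1) = edges C.n := by
  ext ⟨i, j⟩
  rw [Finset.mem_union, mem_sideEdges, mem_sideEdges, mem_edges]
  constructor
  · rintro (h | h) <;> exact h.1
  · intro h
    have := C.V_mem h.1 h.2
    tauto

/-- The two sides together contain all edges and no edge of one crosses an edge of the other, so the
product rule for maximal conflict-free sets applies. -/
theorem tr_eq_mul (C : Chain) : C.tr = C.sideCount 1 * C.sideCount (-1) := by
  rw [sideCount, sideCount, ← C.maximalConflictFree_cross (Or.inl rfl),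
    ← C.maximalConflictFree_cross (Or.inr rfl),
    ← ncard_maximalConflictFree_union (fun _ _ h => h.symm)
      (fun _ he _ hf => C.not_cross_of_sides he hf), sideEdges_union]
  rfl

theorem U_eq_sideCount (C : Chain) : C.U = C.sideCount 1 := by
  rw [sideCount, ← C.maximalConflictFree_cross (Or.inl rfl)]
  have : (fun H => CrossingFree C.n C.p H ∧ ∀ e ∈ H, C.V e.1 e.2 = 0 ∨ C.V e.1 e.2 = 1) =
      ConflictFree (Cross C.p) (C.sideEdges 1) := by
    funext H
    simp only [CrossingFree, ConflictFree, sideEdges, Finset.subset_iff, Finset.mem_filter,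
      eq_iff_iff]
    constructor
    · rintro ⟨⟨h1, h2⟩, h3⟩
      exact ⟨fun e he => ⟨h1 he, h3 e he⟩, h2⟩
    · rintro ⟨h1, h2⟩
      exact ⟨⟨fun e he => (h1 he).1, h2⟩, fun e he => (h1 he).2⟩
  simp only [U, IsUpperTriangulation, maximalConflictFree, this]

/-- Interleaving refers to indices only, so the coordinates of the points play no role once the
admissible edges agree. -/
theorem Same.sideCount_eq {C D : Chain} (h : C.Same D) (s : ℤ) :
    C.sideCount s = D.sideCount s := by
  have : C.sideEdges s = D.sideEdges s := by
    ext ⟨i, j⟩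
    rw [mem_sideEdges, mem_sideEdges, ← h.1]
    exact and_congr_right fun hij => by rw [h.2 i j hij.1 hij.2]
  rw [sideCount, sideCount, this]

/-! ### Sums of chains -/

/-- `C` is a sum of `C₁` and `C₂` with all the entries between the two parts equal to `t`. -/
def IsSum (t : ℤ) (C₁ C₂ C : Chain) : Prop :=
  C.n = C₁.n + C₂.n ∧ ∀ i j, i < j → j ≤ C₁.n + C₂.n →
    C.V i j =
      if j ≤ C₁.n then C₁.V i j
      else if C₁.n ≤ i then C₂.V (i - C₁.n) (j - C₁.n)
      else t

theorem isSum_convexSum (C₁ C₂ : Chain) : IsSum 1 C₁ C₂ (C₁.convexSum C₂) :=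
  (exists_sum 1 (Or.inl rfl) C₁ C₂).choose_spec

theorem isSum_concaveSum (C₁ C₂ : Chain) : IsSum (-1) C₁ C₂ (C₁.concaveSum C₂) :=
  (exists_sum (-1) (Or.inr rfl) C₁ C₂).choose_spec

/-- The translation of edges by `m` indices. -/
def shiftEdge (m : ℕ) : ℕ × ℕ ↪ ℕ × ℕ :=
  (addRightEmbedding m).prodMap (addRightEmbedding m)

/-- Edges of the two summands have index intervals meeting at most in `C₁.n`, so they do not
interleave and the counts multiply. The edges across the junction can only enlarge the set of
admissible edges. -/
theorem IsSum.mul_sideCount_le {t : ℤ} {C₁ C₂ C : Chain} (h : IsSum t C₁ C₂ C) (s : ℤ) :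
    C₁.sideCount s * C₂.sideCount s ≤ C.sideCount s := by
  have hshift := ncard_maximalConflictFree_map_le (R := Interleave) (S := Interleave)
    (shiftEdge C₁.n) (by simp [shiftEdge, Interleave]) (C₂.sideEdges s)
  have hsub : C₁.sideEdges s ∪ (C₂.sideEdges s).map (shiftEdge C₁.n) ⊆ C.sideEdges s := by
    rintro ⟨i, j⟩ he
    rw [mem_sideEdges, h.1]
    rcases Finset.mem_union.1 he with he | he
    · rw [mem_sideEdges] at he
      refine ⟨by omega, ?_⟩
      rw [h.2 i j he.1.1 (by omega), if_pos he.1.2]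
      exact he.2
    · rw [Finset.mem_map] at he
      obtain ⟨⟨a, b⟩, hab, heq⟩ := he
      rw [mem_sideEdges] at hab
      obtain ⟨rfl, rfl⟩ : a + C₁.n = i ∧ b + C₁.n = j := by simpa [shiftEdge] using heq
      refine ⟨by omega, ?_⟩
      rw [h.2 _ _ (by omega) (by omega), if_neg (by omega), if_pos (by omega),
        Nat.add_sub_cancel, Nat.add_sub_cancel]
      exact hab.2
  have hunion := ncard_maximalConflictFree_union (R := Interleave)
    (fun _ _ h => h.symm) (A := C₁.sideEdges s) (B := (C₂.sideEdges s).map (shiftEdge C₁.n)) (by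
      rintro ⟨i, j⟩ he f hf
      rw [Finset.mem_map] at hf
      obtain ⟨⟨a, b⟩, hf, rfl⟩ := hf
      rw [mem_sideEdges] at he hf
      simp only [Interleave, shiftEdge, Function.Embedding.coe_prodMap, Prod.map,
        addRightEmbedding_apply]
      omega)
  calc C₁.sideCount s * C₂.sideCount s
      ≤ C₁.sideCount s *
        (maximalConflictFree Interleave ((C₂.sideEdges s).map (shiftEdge C₁.n))).ncard :=
        Nat.mul_le_mul_left _ hshift
    _ = _ := hunion.symm
    _ ≤ C.sideCount s := ncard_maximalConflictFree_mono hsub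

/-! ### Chains composed of consecutive copies, and comparison with convex powers -/

/-- `C` consists of `N` consecutive copies of `C₀`. -/
def HasBlocks (C₀ : Chain) (N : ℕ) (C : Chain) : Prop :=
  C.n = N * C₀.n ∧ ∀ b, b < N → ∀ i j, i < j → j ≤ C₀.n →
    C.V (b * C₀.n + i) (b * C₀.n + j) = C₀.V i j

theorem HasBlocks.self (C₀ : Chain) : HasBlocks C₀ 1 C₀ := by
  refine ⟨by simp, fun b hb i j _ _ => ?_⟩
  obtain rfl : b = 0 := by omega
  simp

/-- A sum of either kind keeps the entries inside each summand, so the block structure forgets the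
formula except for its number of copies. -/
theorem IsSum.hasBlocks {t : ℤ} {C₀ C₁ C₂ C : Chain} {N₁ N₂ : ℕ} (h : IsSum t C₁ C₂ C)
    (h₁ : HasBlocks C₀ N₁ C₁) (h₂ : HasBlocks C₀ N₂ C₂) : HasBlocks C₀ (N₁ + N₂) C := by
  refine ⟨by rw [h.1, h₁.1, h₂.1, add_mul], fun b hb i j hij hj => ?_⟩
  rcases Nat.lt_or_ge b N₁ with hb' | hb'
  · have hle : b * C₀.n + j ≤ C₁.n := by rw [h₁.1]; nlinarith
    rw [h.2 _ _ (by omega) (by omega), if_pos hle, h₁.2 b hb' i j hij hj]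
  -- Block `N₁ + c` of the sum is block `c` of the second summand.
  · obtain ⟨c, rfl⟩ := Nat.exists_eq_add_of_le hb'
    have hle : c * C₀.n + j ≤ C₂.n := by
      have : c < N₂ := by omega
      rw [h₂.1]; nlinarith
    have e : (N₁ + c) * C₀.n = C₁.n + c * C₀.n := by rw [h₁.1, add_mul]
    rw [e, h.2 _ _ (by omega) (by omega), if_neg (by omega), if_pos (by omega), add_assoc,
      add_assoc, Nat.add_sub_cancel_left, Nat.add_sub_cancel_left, h₂.2 c (by omega) i j hij hj]

theorem hasBlocks_convexPower (C₀ : Chain) (k : ℕ) : HasBlocks C₀ (k + 1) (C₀.convexPower k) := by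
  induction k with
  | zero => exact HasBlocks.self C₀
  | succ k ih => exact (isSum_convexSum _ _).hasBlocks ih (HasBlocks.self C₀)

/-- Edges of a convex power either belong to one of the copies or are upper edges. -/
theorem convexPower_block_or_upper (C₀ : Chain) (k : ℕ) {i j : ℕ} (hij : i < j)
    (hj : j ≤ (C₀.convexPower k).n) :
    (∃ b a c, b < k + 1 ∧ a < c ∧ c ≤ C₀.n ∧ i = b * C₀.n + a ∧ j = b * C₀.n + c) ∨
      (C₀.convexPower k).V i j = 1 := by
  induction k generalizing i j with
  | zero => exact Or.inl ⟨0, i, j, by omega, hij, hj, by simp, by simp⟩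
  | succ k ih =>
    have hsum := isSum_convexSum (C₀.convexPower k) C₀
    have hn := (hasBlocks_convexPower C₀ k).1
    have hj' : j ≤ (C₀.convexPower k).n + C₀.n := hsum.1 ▸ hj
    change _ ∨ ((C₀.convexPower k).convexSum C₀).V i j = 1
    rw [hsum.2 i j hij hj']
    split_ifs with h1 h2
    · rcases ih hij h1 with ⟨b, a, c, hb, h⟩ | h
      · exact Or.inl ⟨b, a, c, by omega, h⟩
      · exact Or.inr h
    -- The last copy has block index `k + 1` and starts at `(C₀.convexPower k).n = (k + 1) * C₀.n`.
    · refine Or.inl ⟨k + 1, i - (C₀.convexPower k).n, j - (C₀.convexPower k).n, ?_⟩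
      omega
    · exact Or.inr rfl

/-- Every edge admissible on side `s` of `C` is admissible above the convex power of `E`: inside a
block by `hV`, between blocks because all such edges are upper edges there. Monotonicity does the
rest. In the application `E` is `C₀.flip` for `s = -1` and `C₀.flip.flip` for `s = 1`. -/
theorem HasBlocks.sideCount_le {C₀ E C : Chain} {k : ℕ} (h : HasBlocks C₀ (k + 1) C) (s : ℤ)
    (hn : E.n = C₀.n) (hV : ∀ i j, i < j → j ≤ C₀.n → C₀.V i j = s → E.V i j = 1) :
    C.sideCount s ≤ (E.convexPower k).U := by
  rw [U_eq_sideCount]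
  refine ncard_maximalConflictFree_mono ?_
  rintro ⟨i, j⟩ he
  rw [mem_sideEdges] at he ⊢
  have hE := hasBlocks_convexPower E k
  have hj : j ≤ (E.convexPower k).n := by rw [hE.1, hn, ← h.1]; exact he.1.2
  refine ⟨⟨he.1.1, hj⟩, ?_⟩
  rcases convexPower_block_or_upper E k he.1.1 hj with ⟨b, a, c, hb, hac, hc, rfl, rfl⟩ | h1
  · rw [hE.2 b hb a c hac hc]
    have hVC := he.2
    rw [hn, h.2 b hb a c hac (hn ▸ hc)] at hVC
    rcases hVC with h0 | h0
    -- The entry `0` occurs only at chain edges, and these are chain edges of `E` as well.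
    · left
      rcases C₀.V_cases hac (hn ▸ hc) with rfl | h' | h'
      · exact E.V_succ a
      · omega
      · omega
    · exact Or.inr (hV a c hac (hn ▸ hc) h0)
  · exact Or.inr h1

end Chain

/-! ### Induction over formulas and the final estimate -/

namespace SumFormula

theorem one_le_copies (F : SumFormula) : 1 ≤ F.copies := by
  induction F with
  | copy => exact le_rfl
  | convex F G hF hG => exact hF.trans (Nat.le_add_right _ _)
  | concave F G hF hG => exact hF.trans (Nat.le_add_right _ _)

theorem hasBlocks_eval (C₀ : Chain) (F : SumFormula) :
    Chain.HasBlocks C₀ F.copies (F.eval C₀) := by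
  induction F with
  | copy => exact Chain.HasBlocks.self C₀
  | convex F G hF hG => exact (Chain.isSum_convexSum _ _).hasBlocks hF hG
  | concave F G hF hG => exact (Chain.isSum_concaveSum _ _).hasBlocks hF hG

theorem pow_sideCount_le (C₀ : Chain) (F : SumFormula) (s : ℤ) :
    C₀.sideCount s ^ F.copies ≤ (F.eval C₀).sideCount s := by
  induction F with
  | copy => exact (pow_one _).le
  | convex F G hF hG =>
    rw [copies, pow_add]
    exact (Nat.mul_le_mul hF hG).trans ((Chain.isSum_convexSum _ _).mul_sideCount_le s)
  | concave F G hF hG =>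
    rw [copies, pow_add]
    exact (Nat.mul_le_mul hF hG).trans ((Chain.isSum_concaveSum _ _).mul_sideCount_le s)

end SumFormula

theorem mainTheorem11 (C₀ C : Chain) (N : ℕ)
    (hC : ∃ F : SumFormula, F.copies = N ∧ C.Same (F.eval C₀)) :
    C₀.tr ^ N ≤ C.tr ∧ C.tr ≤ (C₀.poly N).U * (C₀.flip.poly N).U := by
  obtain ⟨F, rfl, hF⟩ := hC
  rw [C.tr_eq_mul, C₀.tr_eq_mul, hF.sideCount_eq, hF.sideCount_eq, mul_pow]
  refine ⟨Nat.mul_le_mul (F.pow_sideCount_le C₀ 1) (F.pow_sideCount_le C₀ (-1)), ?_⟩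
  have hb := F.hasBlocks_eval C₀
  -- With `k + 1` copies, the truncated subtraction `N - 1` in `poly` is the exponent `k`, and
  -- `convexPower k` has exactly `k + 1` copies.
  obtain ⟨k, hk⟩ := Nat.exists_eq_add_of_le' F.one_le_copies
  rw [hk] at hb ⊢
  -- The poly chain of `C₀` is built from flipped copies and bounds the lower side, so the lower
  -- count is moved to the front.
  rw [mul_comm]
  refine Nat.mul_le_mul (hb.sideCount_le (-1) rfl fun i j hij hj h => ?_)
    (hb.sideCount_le 1 rfl fun i j hij hj h => ?_)
  · rw [C₀.V_flip hij hj, h, neg_neg]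
  · rw [C₀.flip.V_flip hij hj, C₀.V_flip hij hj, h, neg_neg]
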